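/- Theorem (Linear convergence of consensus error). Let $\mathcal M\subset\mathbb R^{d\times r}$ be a compact embedded $C^2$ submanifold (without boundary; in particular, any compact smooth submanifold), where $\mathbb R^{d\times r}$ carries the Euclidean (Frobenius) norm $\|\cdot\|$. For $x\in\mathbb R^{d\times r}$ let $\mathcal P_{\mathcal M}(x)=\arg\min_{y\in\mathcal M}\|y-x\|$, and let $\gamma>0$ be such that $\mathcal M$ is $2\gamma$-proximally smooth, i.e. $\mathcal P_{\mathcal M}(x)$ is a singleton whenever $\mathrm{dist}(x,\mathcal M)<2\gamma$. Let $G$ be a connected undirected graph on $\{1,\dots,n\}$ and let $W\in\mathbb R^{n\times n}$ be a doubly stochastic matrix such that $W=W^\top$; for $i\ne j$, $W_{ij}>0$ if $\{i,j\}$ is an edge of $G$ and $W_{ij}=0$ otherwise; $0<W_{ii}<1$ for all $i$; the eigenvalues of $W$ lie in $(-1,1]$; and the second largest singular value $\sigma_2$ of $W$ (counted with multiplicity) lies in $[0,1)$. For $\mathbf x=(x_1,\dots,x_n)\in\mathcal M^n$ write $\hat x=\frac1n\sum_{i=1}^n x_i$, and put $$\mathcal N=\Big\{\mathbf x\in\mathcal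 M^n:\ \max_i\|x_i-\bar x\|\le \tfrac{\gamma}{2}\ \text{ for some } \bar x\in\mathcal P_{\mathcal M}(\hat x)\Big\},\qquad \zeta=\max_{x,y\in\mathcal M}\|x-y\|.$$ Let $t$ be a nonnegative integer with $$t>\max\left\{\left\lceil\log_{\sigma_2}\!\Big(\frac{\gamma}{24\sqrt n\,\zeta}\Big)\right\rceil,\ \left\lceil\log_{\sigma_2}\!\Big(\frac12\Big)\right\rceil\right\},$$ where a logarithm that is undefined because $\sigma_2=0$ or $\zeta=0$ is read as $0$. Let $\mathbf x_k=(x_{1,k},\dots,x_{n,k})$, $k\ge 0$, be any sequence with $\mathbf x_0\in\mathcal N$ and $$x_{i,k+1}\in\mathcal P_{\mathcal M}\Big(\sum_{j=1}^n (W^t)_{ij}\,x_{j,k}\Big),\qquad i=1,\dots,n,\ k\ge0.$$ Then $\rho_t:=2\sigma_2^t<1$; $\mathbf x_k\in\mathcal N$ for all $k\ge 0$; for every $k\ge 0$ the set $\mathcal P_{\mathcal M}(\hat x_k)$ consists of a single point $\bar x_k$; and, writing $\|\mathbf x_k-\bar{\mathbf x}_k\|=\big(\sum_{i=1}^n\|x_{i,k}-\bar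 x_k\|^2\big)^{1/2}$, $$\|\mathbf x_{k+1}-\bar{\mathbf x}_{k+1}\|\le\rho_t\,\|\mathbf x_k-\bar{\mathbf x}_k\|\qquad\text{for all } k\ge0.$$ -/

import Mathlib

noncomputable section

namespace Consensus

/-- The space of real `d × r` matrices with the Euclidean (Frobenius) inner product and norm. -/
abbrev RMat (d r : ℕ) : Type := EuclideanSpace ℝ (Fin d × Fin r)

section Geometry

variable {E : Type*} [NormedAddCommGroup E]

/-- The set-valued nearest-point projection: all minimizers of `y ↦ ‖y - x‖` over `M`. -/
def proj (M : Set E) (x : E) : Set E :=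
  {a | a ∈ M ∧ ∀ y ∈ M, ‖a - x‖ ≤ ‖y - x‖}

/-- `M` is closed and every point at distance less than `R` from `M` has exactly one nearest
point in `M`. -/
def IsProximallySmooth (M : Set E) (R : ℝ) : Prop :=
  IsClosed M ∧ ∀ x : E, Metric.infDist x M < R → ∃! a, a ∈ proj M x

/-- Embedded `C^p` submanifold (without boundary) of a normed space, given by local defining
functions: for a fixed codimension `c`, near each of its points `M` is the zero set of a `C^p` map
into `ℝ^c` whose derivative is onto at the points of `M`. -/
def IsSubmanifold [NormedSpace ℝ E] (p : WithTop ℕ∞) (M : Set E) : Prop :=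
  ∃ c : ℕ, ∀ x ∈ M, ∃ U : Set E, IsOpen U ∧ x ∈ U ∧
    ∃ h : E → EuclideanSpace ℝ (Fin c), ContDiffOn ℝ p h U ∧
      M ∩ U = {y ∈ U | h y = 0} ∧
      ∀ y ∈ M ∩ U, Function.Surjective (fderiv ℝ h y)

/-- The Euclidean average of `x 1, …, x n`. -/
def mean [NormedSpace ℝ E] {n : ℕ} (x : Fin n → E) : E :=
  (1 / (n : ℝ)) • ∑ i, x i

/-- The neighborhood `𝒩`: tuples of points of `M`, all within `γ / 2` of a projection of their
Euclidean mean onto `M`. -/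
def neighborhood [NormedSpace ℝ E] (M : Set E) (γ : ℝ) (n : ℕ) : Set (Fin n → E) :=
  {x | (∀ i, x i ∈ M) ∧ ∃ a ∈ proj M (mean x), ∀ i, ‖x i - a‖ ≤ γ / 2}

/-- The norm `‖𝐱 - 𝟏 ⊗ a‖` of the stacked vector, i.e. `(∑ i, ‖x i - a‖ ^ 2) ^ (1 / 2)`. -/
def stackedError {n : ℕ} (x : Fin n → E) (a : E) : ℝ :=
  √(∑ i, ‖x i - a‖ ^ 2)

/-- `x k i` is the `i`-th agent's `k`-th iterate of the projected consensus iteration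
`x_{i,k+1} = P_M (∑ j, (W^t)_{ij} x_{j,k})`; where the nearest point is not unique, any one may be
taken. -/
def IsConsensusIteration [NormedSpace ℝ E] (M : Set E) {n : ℕ} (W : Matrix (Fin n) (Fin n) ℝ)
    (t : ℕ) (x : ℕ → Fin n → E) : Prop :=
  ∀ k i, x (k + 1) i ∈ proj M (∑ j, (W ^ t) i j • x k j)

end Geometry

/-- The second largest singular value, counted with multiplicity (Mathlib numbers the decreasing
sequence of singular values from `0`). -/
def sigma₂ {n : ℕ} (W : Matrix (Fin n) (Fin n) ℝ) : ℝ :=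
  (Matrix.toEuclideanLin W).singularValues 1

/-- The standing assumption on the mixing matrix `W` of the undirected network `G`. -/
structure IsMixingMatrix {n : ℕ} (G : SimpleGraph (Fin n)) (W : Matrix (Fin n) (Fin n) ℝ) :
    Prop where
  connected : G.Connected
  pos_of_adj : ∀ i j, G.Adj i j → 0 < W i j
  zero_of_not_adj : ∀ i j, i ≠ j → ¬ G.Adj i j → W i j = 0
  doubly_stochastic : W ∈ doublyStochastic ℝ (Fin n)
  symmetric : W.IsSymm
  diag_pos : ∀ i, 0 < W i i
  diag_lt_one : ∀ i, W i i < 1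
  eigenvalues_mem : ∀ μ : ℝ, Module.End.HasEigenvalue (Matrix.toLin' W) μ → μ ∈ Set.Ioc (-1) 1
  sigma₂_mem : sigma₂ W ∈ Set.Ico 0 1

end Consensus

end

namespace Consensus

/-! ### Lipschitz continuity of the nearest-point projection -/

section Projection

open Metric

variable {E : Type*} [NormedAddCommGroup E] {M : Set E} {x y a b : E} {R s : ℝ}

/-! Let `a` project the mean of the current iterate. The mean and the mixed points all lie in the
ball of radius γ/2 about `a`, where projection is 2-Lipschitz, and mixing contracts deviations from
the mean by σ₂^t. So the new points have stacked error about `a` at most 2σ₂^t times the old one,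
and replacing `a` by the new projected mean only lowers it, because a projected mean minimizes the
stacked error over `M`.

The constant 2 (`norm_sub_le_two_mul_of_mem_proj`) is the geometric core. Uniqueness of nearest
points makes the distance to `M` grow at unit rate throughout the tube, so a nearest point remains
nearest along its outward normal ray. This yields a quadratic bound on normal components
(`inner_sub_le_of_mem_proj`), and adding two such bounds gives the Lipschitz estimate. The
contraction by σ₂ is spectral (`norm_apply_le_of_inner_eq_zero`), and the lower bound on t makes the
error small enough for the iterates to stay in 𝒩. -/

theorem infDist_eq_of_mem_proj (ha : a ∈ proj M x) : infDist x M = ‖a - x‖ := by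
  refine le_antisymm ?_ ?_
  · rw [← dist_eq_norm, dist_comm]
    exact infDist_le_dist_of_mem ha.1
  · refine (le_infDist ⟨a, ha.1⟩).2 fun y hy => ?_
    rw [dist_comm, dist_eq_norm]
    exact ha.2 y hy

theorem mem_proj_of_infDist (ha : a ∈ M) (h : ‖a - x‖ ≤ infDist x M) : a ∈ proj M x := by
  refine ⟨ha, fun y hy => h.trans ?_⟩
  rw [← dist_eq_norm, dist_comm]
  exact infDist_le_dist_of_mem hy

theorem exists_mem_proj (hM : IsCompact M) (hne : M.Nonempty) (x : E) : ∃ a, a ∈ proj M x := by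
  obtain ⟨a, ha, h⟩ := hM.exists_infDist_eq_dist hne x
  refine ⟨a, mem_proj_of_infDist ha ?_⟩
  rw [h, dist_comm, dist_eq_norm]

variable [InnerProductSpace ℝ E]

/-- Where the nearest point `a` is unique, the distance to `M` grows at unit rate in the direction
pointing away from `a`. -/
theorem exists_forall_add_mul_le_infDist (hM : IsCompact M) (ha : a ∈ proj M y)
    (huniq : ∀ b ∈ proj M y, b = a) (hya : y ≠ a) {c : ℝ} (hc₀ : 0 ≤ c) (hc : c < 1) :
    ∃ t₀ > 0, ∀ t, 0 < t → t < t₀ →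
      infDist y M + c * t ≤ infDist (y + t • (‖y - a‖⁻¹ • (y - a))) M := by
  have hpos : 0 < ‖y - a‖ := norm_pos_iff.2 (sub_ne_zero.2 hya)
  set u := ‖y - a‖⁻¹ • (y - a) with hu
  have hu1 : ‖u‖ = 1 := by
    rw [hu, norm_smul, norm_inv, norm_norm, inv_mul_cancel₀ hpos.ne']
  have hua : inner ℝ u (y - a) = ‖y - a‖ := by
    rw [hu, real_inner_smul_left, real_inner_self_eq_norm_sq, sq, inv_mul_cancel_left₀ hpos.ne']
  -- `K` collects the points from which moving along `u` may gain distance at rate at most `c`. At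
  -- `a` the rate is one, so `K` avoids the only nearest point and, by compactness, stays at
  -- distance at least some `m > infDist y M`.
  set K := M ∩ {z | inner ℝ u (y - z) ≤ c * ‖y - z‖} with hK
  have hKc : IsCompact K := hM.inter_right (isClosed_le (by fun_prop) (by fun_prop))
  have hKlt : ∀ z ∈ K, infDist y M < ‖y - z‖ := by
    intro z hz
    by_contra! hle
    rw [norm_sub_rev] at hle
    have hza := huniq z (mem_proj_of_infDist hz.1 hle)
    have := hz.2
    simp only [Set.mem_ofPred_eq, hza, hua] at this
    nlinarith
  obtain ⟨m, hm, hmK⟩ : ∃ m, infDist y M < m ∧ ∀ z ∈ K, m ≤ ‖y - z‖ := by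
    rcases K.eq_empty_or_nonempty with h | h
    · exact ⟨infDist y M + 1, by linarith, by simp [h]⟩
    · obtain ⟨z, hz, hmin⟩ := hKc.exists_isMinOn h
        (f := fun z => ‖y - z‖) (by fun_prop)
      exact ⟨‖y - z‖, hKlt z hz, fun w hw => hmin hw⟩
  -- A nearest point of `y + t • u` is within `infDist y M + 2 * t` of `y`; this `t₀` keeps it
  -- closer than `m`, hence outside `K`.
  refine ⟨(m - infDist y M) / 2, by linarith, fun t ht htm => ?_⟩
  obtain ⟨z, hz⟩ := exists_mem_proj hM ⟨a, ha.1⟩ (y + t • u)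
  have htu : ‖t • u‖ = t := by rw [norm_smul, hu1, mul_one, Real.norm_of_nonneg ht.le]
  have h1 : infDist (y + t • u) M ≤ infDist y M + t := by
    have := infDist_le_infDist_add_dist (x := y + t • u) (y := y) (s := M)
    rwa [dist_eq_norm, add_sub_cancel_left, htu] at this
  have heq : infDist (y + t • u) M = ‖(y - z) + t • u‖ := by
    rw [infDist_eq_of_mem_proj hz, norm_sub_rev]; congr 1; abel
  have h2 : ‖y - z‖ < m := by
    have : ‖y - z‖ ≤ ‖(y - z) + t • u‖ + ‖t • u‖ := norm_le_add_norm_add _ _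
    rw [← heq, htu] at this
    linarith
  have h3 : c * ‖y - z‖ < inner ℝ u (y - z) := by
    by_contra! hle
    exact absurd (hmK z ⟨hz.1, hle⟩) (not_le.2 h2)
  have h4 : infDist y M ≤ ‖y - z‖ := by
    rw [← dist_eq_norm]; exact infDist_le_dist_of_mem hz.1
  have h5 : ‖y - z‖ + c * t ≤ ‖(y - z) + t • u‖ := by
    refine le_of_sq_le_sq ?_ (norm_nonneg _)
    rw [norm_add_sq_real, htu, real_inner_smul_right, real_inner_comm]
    nlinarith [mul_lt_mul_of_pos_left h3 ht, mul_pos ht ht,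
      mul_nonneg (sub_nonneg.2 hc.le) (by linarith : 0 ≤ 1 + c)]
  rw [heq]
  linarith

variable [ProperSpace E]

/-- In a ball that stays in the tube of uniqueness, the distance to `M` grows by the full radius. -/
theorem exists_add_le_infDist (hM : IsCompact M) (hR : IsProximallySmooth M R)
    {δ : ℝ} (hδ : 0 ≤ δ) (hx : 0 < infDist x M) (hxR : infDist x M + δ < R) :
    ∃ y ∈ closedBall x δ, infDist x M + δ ≤ infDist y M := by
  -- Maximize `infDist y M - c * ‖y - x‖` on the ball: at a maximizer of norm distance less than `δ`
  -- from `x`, moving outwards at the rate `(1 + c) / 2 > c` would increase it. Then `c` tends to 1.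
  have key : ∀ c : ℝ, 0 < c → c < 1 → ∃ y ∈ closedBall x δ, infDist x M + c * δ ≤ infDist y M := by
    intro c hc₀ hc
    obtain ⟨y, hy, hmax⟩ := (isCompact_closedBall x δ).exists_isMaxOn
      (nonempty_closedBall.2 hδ) (f := fun y => infDist y M - c * ‖y - x‖)
      ((continuous_infDist_pt M).sub (by fun_prop)).continuousOn
    have hyδ : ‖y - x‖ ≤ δ := by rwa [mem_closedBall, dist_eq_norm] at hy
    have hxy : infDist x M ≤ infDist y M - c * ‖y - x‖ := by
      simpa using hmax (mem_closedBall_self hδ)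
    have hdy : infDist y M ≤ infDist x M + ‖y - x‖ := by
      rw [← dist_eq_norm]; exact infDist_le_infDist_add_dist
    refine ⟨y, hy, ?_⟩
    rcases hyδ.eq_or_lt with h | h
    · rw [← h]; linarith
    exfalso
    obtain ⟨a, ha, huniq⟩ := hR.2 y (by linarith)
    have hpos : 0 < infDist y M := by
      have := mul_nonneg hc₀.le (norm_nonneg (y - x)); linarith
    have hya : y ≠ a := by
      rintro rfl
      rw [infDist_eq_of_mem_proj ha, sub_self, norm_zero] at hpos
      exact lt_irrefl _ hpos
    have hn : 0 < ‖y - a‖ := norm_pos_iff.2 (sub_ne_zero.2 hya)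
    obtain ⟨t₀, ht₀, hgrow⟩ := exists_forall_add_mul_le_infDist hM ha huniq hya
      (c := (1 + c) / 2) (by linarith) (by linarith)
    obtain ⟨t, ht, htlt⟩ := exists_between (lt_min ht₀ (sub_pos.2 h))
    have h1 := hgrow t ht (htlt.trans_le (min_le_left _ _))
    have htu : ‖t • (‖y - a‖⁻¹ • (y - a))‖ = t := by
      rw [norm_smul, norm_smul, norm_inv, norm_norm, inv_mul_cancel₀ hn.ne', mul_one,
        Real.norm_of_nonneg ht.le]
    set w := y + t • (‖y - a‖⁻¹ • (y - a)) with hw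
    have hwx : ‖w - x‖ ≤ ‖y - x‖ + t := by
      have : w - x = (y - x) + t • (‖y - a‖⁻¹ • (y - a)) := by rw [hw]; abel
      rw [this]
      exact (norm_add_le _ _).trans_eq (by rw [htu])
    have h2 : infDist w M - c * ‖w - x‖ ≤ infDist y M - c * ‖y - x‖ := by
      refine hmax ?_
      rw [mem_closedBall, dist_eq_norm]
      linarith [htlt.trans_le (min_le_right _ _)]
    nlinarith [mul_le_mul_of_nonneg_left hwx hc₀.le]
  obtain ⟨y, hy, hmax⟩ := (isCompact_closedBall x δ).exists_isMaxOn
    (nonempty_closedBall.2 hδ) (continuous_infDist_pt M).continuousOn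
  refine ⟨y, hy, le_of_forall_pos_sub_le fun ε hε => ?_⟩
  -- The loss `(1 - c) * δ` is then below `ε`; `δ + 1` avoids dividing by zero.
  obtain ⟨c, hc, hc1⟩ := exists_between
    (max_lt (zero_lt_one (α := ℝ)) (sub_lt_self 1 (div_pos hε (by linarith : 0 < δ + 1))))
  obtain ⟨z, hz, h⟩ := key c ((le_max_left _ _).trans_lt hc) hc1
  have h3 : infDist z M ≤ infDist y M := hmax hz
  have h4 : 1 - ε / (δ + 1) < c := (le_max_right _ _).trans_lt hc
  have h5 : (1 - c) * (δ + 1) < ε := by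
    rw [← lt_div_iff₀ (by linarith)]; linarith
  nlinarith

/-- Nearest points are preserved when moving outwards along the normal ray, as long as one stays
in the tube of uniqueness. -/
theorem mem_proj_add_smul (hM : IsCompact M) (hR : IsProximallySmooth M R) (ha : a ∈ proj M x)
    (hxa : x ≠ a) (hxs : ‖x - a‖ ≤ s) (hs : s < R) :
    a ∈ proj M (a + (s / ‖x - a‖) • (x - a)) := by
  have hn : 0 < ‖x - a‖ := norm_pos_iff.2 (sub_ne_zero.2 hxa)
  have hd : infDist x M = ‖x - a‖ := by rw [infDist_eq_of_mem_proj ha, norm_sub_rev]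
  obtain ⟨y, hy, hle⟩ := exists_add_le_infDist (δ := s - ‖x - a‖) hM hR
    (by linarith) (by linarith) (by linarith)
  rw [mem_closedBall, dist_eq_norm] at hy
  rw [hd, add_sub_cancel] at hle
  have hya : infDist y M ≤ ‖y - a‖ := by
    rw [← dist_eq_norm]; exact infDist_le_dist_of_mem ha.1
  have hsplit : y - a = (y - x) + (x - a) := by abel
  have htri : ‖y - a‖ ≤ ‖y - x‖ + ‖x - a‖ := hsplit ▸ norm_add_le _ _
  have hyx : ‖y - x‖ = s - ‖x - a‖ := by linarith
  have hya' : ‖y - a‖ = s := by linarith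
  -- Equality in the triangle inequality forces `y` onto the ray from `a` through `x`.
  have hray : SameRay ℝ (y - x) (x - a) := by
    rw [sameRay_iff_norm_add, ← hsplit, hya', hyx]; ring
  have hys : y = a + (s / ‖x - a‖) • (x - a) := by
    have h := hray.norm_smul_eq
    rw [hyx] at h
    have h' : y - x = (‖x - a‖⁻¹ * (s - ‖x - a‖)) • (x - a) := by
      rw [mul_smul, h, smul_smul, inv_mul_cancel₀ hn.ne', one_smul]
    have h'' : s / ‖x - a‖ = ‖x - a‖⁻¹ * (s - ‖x - a‖) + 1 := by field_simp; ring
    rw [h'', add_smul, one_smul, ← h']; abel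
  rw [← hys]
  refine mem_proj_of_infDist ha.1 ?_
  rw [norm_sub_rev]; linarith

/-- The open ball of radius `s` about the point pushed out along the normal ray misses `M`;
expanding the squared distance from its centre to `b` gives the bound. -/
theorem inner_sub_le_of_mem_proj (hM : IsCompact M) (hR : IsProximallySmooth M R)
    (ha : a ∈ proj M x) (hxs : ‖x - a‖ ≤ s) (hs₀ : 0 < s) (hs : s < R) (hb : b ∈ M) :
    inner ℝ (x - a) (b - a) ≤ ‖x - a‖ / (2 * s) * ‖b - a‖ ^ 2 := by
  rcases eq_or_ne x a with rfl | hxa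
  · simp
  have hn : 0 < ‖x - a‖ := norm_pos_iff.2 (sub_ne_zero.2 hxa)
  have h := (mem_proj_add_smul hM hR ha hxa hxs hs).2 b hb
  set v := (s / ‖x - a‖) • (x - a) with hv
  have h1 : ‖v‖ ^ 2 ≤ ‖(b - a) - v‖ ^ 2 := by
    refine pow_le_pow_left₀ (norm_nonneg _) ?_ 2
    rw [sub_add_cancel_left, norm_neg] at h
    rwa [sub_sub]
  rw [norm_sub_sq_real, hv, real_inner_smul_right, real_inner_comm] at h1
  have h2 : 2 * (s / ‖x - a‖) * inner ℝ (x - a) (b - a) ≤ ‖b - a‖ ^ 2 := by linarith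
  calc inner ℝ (x - a) (b - a)
      = ‖x - a‖ / (2 * s) * (2 * (s / ‖x - a‖) * inner ℝ (x - a) (b - a)) := by field_simp
    _ ≤ _ := mul_le_mul_of_nonneg_left h2 (by positivity)

/-- The projection onto a `2γ`-proximally smooth set is `2`-Lipschitz on the tube of radius
`γ / 2`. -/
theorem norm_sub_le_two_mul_of_mem_proj {γ : ℝ} (hγ : 0 < γ) (hM : IsCompact M)
    (hR : IsProximallySmooth M (2 * γ)) (ha : a ∈ proj M x) (hb : b ∈ proj M y)
    (hxa : ‖x - a‖ ≤ γ / 2) (hyb : ‖y - b‖ ≤ γ / 2) : ‖b - a‖ ≤ 2 * ‖y - x‖ := by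
  -- With `s = γ` the coefficient is at most (γ/2)/(2γ) = 1/4; the two bounds together absorb half
  -- of `‖b - a‖ ^ 2`.
  have aux : ∀ {x a b : E}, a ∈ proj M x → b ∈ M → ‖x - a‖ ≤ γ / 2 →
      inner ℝ (x - a) (b - a) ≤ 1 / 4 * ‖b - a‖ ^ 2 := fun {x a b} ha hb hxa => by
    refine (inner_sub_le_of_mem_proj hM hR ha (by linarith) hγ (by linarith) hb).trans ?_
    refine mul_le_mul_of_nonneg_right ?_ (sq_nonneg _)
    rw [div_le_iff₀ (by positivity)]
    linarith
  have h1 := aux ha hb.1 hxa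
  have h2 := aux hb ha.1 hyb
  have h3 : inner ℝ (x - a) (b - a) + inner ℝ (y - b) (a - b)
      = ‖b - a‖ ^ 2 - inner ℝ (y - x) (b - a) := by
    rw [← neg_sub b a, inner_neg_right, ← sub_eq_add_neg, ← inner_sub_left,
      ← real_inner_self_eq_norm_sq, ← inner_sub_left]
    congr 1
    abel
  have h4 := real_inner_le_norm (y - x) (b - a)
  rw [norm_sub_rev a b] at h2
  have h5 : ‖b - a‖ * ‖b - a‖ ≤ 2 * ‖y - x‖ * ‖b - a‖ := by nlinarith
  rcases (norm_nonneg (b - a)).eq_or_lt with h | h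
  · rw [← h]; positivity
  · exact le_of_mul_le_mul_right h5 h

end Projection

/-! ### Means and the stacked error -/

section Mean

variable {E : Type*} [NormedAddCommGroup E] {n : ℕ}

theorem norm_sub_le_stackedError (x : Fin n → E) (a : E) (i : Fin n) :
    ‖x i - a‖ ≤ stackedError x a :=
  Real.le_sqrt_of_sq_le (Finset.single_le_sum (f := fun i => ‖x i - a‖ ^ 2)
    (fun _ _ => sq_nonneg _) (Finset.mem_univ i))

theorem stackedError_le_mul_of_forall_norm_sub_le {x y : Fin n → E} {a b : E} {c : ℝ}
    (hc : 0 ≤ c) (h : ∀ i, ‖x i - a‖ ≤ c * ‖y i - b‖) :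
    stackedError x a ≤ c * stackedError y b := by
  rw [stackedError, stackedError, Real.sqrt_le_left (mul_nonneg hc (Real.sqrt_nonneg _)), mul_pow,
    Real.sq_sqrt (by positivity), Finset.mul_sum]
  refine Finset.sum_le_sum fun i _ => ?_
  rw [← mul_pow]
  exact pow_le_pow_left₀ (norm_nonneg _) (h i) 2

theorem stackedError_le_sqrt_mul {x : Fin n → E} {a : E} {c : ℝ} (hc : 0 ≤ c)
    (h : ∀ i, ‖x i - a‖ ≤ c) : stackedError x a ≤ √n * c := by
  rw [stackedError, Real.sqrt_le_left (by positivity), mul_pow, Real.sq_sqrt (by positivity)]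
  refine (Finset.sum_le_card_nsmul _ _ (c ^ 2) fun i _ =>
    pow_le_pow_left₀ (norm_nonneg _) (h i) 2).trans_eq ?_
  simp

variable [InnerProductSpace ℝ E] {M : Set E}

theorem sum_sub_mean (x : Fin n → E) : ∑ i, (x i - mean x) = 0 := by
  rcases Nat.eq_zero_or_pos n with rfl | hn
  · simp
  have hn0 : (n : ℝ) ≠ 0 := by positivity
  rw [Finset.sum_sub_distrib, Finset.sum_const, Finset.card_univ, Fintype.card_fin, mean,
    ← Nat.cast_smul_eq_nsmul ℝ, smul_smul, mul_one_div_cancel hn0, one_smul, sub_self]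

theorem mean_mem_of_convex {s : Set E} (hs : Convex ℝ s) (hn : n ≠ 0) {x : Fin n → E}
    (hx : ∀ i, x i ∈ s) : mean x ∈ s := by
  rw [mean, Finset.smul_sum]
  refine hs.sum_mem (fun _ _ => by positivity) ?_ fun i _ => hx i
  simp [hn]

theorem sum_norm_sub_sq (x : Fin n → E) (a : E) :
    ∑ i, ‖x i - a‖ ^ 2 = ∑ i, ‖x i - mean x‖ ^ 2 + n * ‖mean x - a‖ ^ 2 := by
  have h : ∀ i, ‖x i - a‖ ^ 2
      = ‖x i - mean x‖ ^ 2 + 2 * inner ℝ (x i - mean x) (mean x - a) + ‖mean x - a‖ ^ 2 := by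
    intro i
    rw [← norm_add_sq_real, sub_add_sub_cancel]
  simp_rw [h, Finset.sum_add_distrib, ← Finset.mul_sum, ← sum_inner, sum_sub_mean]
  simp

theorem stackedError_mean_le (x : Fin n → E) (a : E) :
    stackedError x (mean x) ≤ stackedError x a := by
  refine Real.sqrt_le_sqrt ?_
  rw [sum_norm_sub_sq x a]
  exact le_add_of_nonneg_right (by positivity)

/-- A projection of the mean minimizes the stacked error over `M`. -/
theorem stackedError_le_of_mem_proj_mean {x : Fin n → E} {a b : E} (ha : a ∈ proj M (mean x))
    (hb : b ∈ M) : stackedError x a ≤ stackedError x b := by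
  refine Real.sqrt_le_sqrt ?_
  rw [sum_norm_sub_sq x a, sum_norm_sub_sq x b, norm_sub_rev _ a, norm_sub_rev _ b]
  have := pow_le_pow_left₀ (norm_nonneg _) (ha.2 b hb) 2
  gcongr

end Mean

/-! ### Contraction by the mixing matrix -/

section Mixing

open Matrix

/-- A linear map whose Gram operator fixes `e ≠ 0` and whose second singular value is less than `1`
contracts the orthogonal complement of `e` by that singular value. -/
theorem norm_apply_le_of_inner_eq_zero {V : Type*} [NormedAddCommGroup V] [InnerProductSpace ℝ V]
    [FiniteDimensional ℝ V] (T : V →ₗ[ℝ] V) {e u : V} (he : e ≠ 0)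
    (hTe : LinearMap.adjoint T (T e) = e) (hσ : T.singularValues 1 < 1) (hu : inner ℝ e u = 0) :
    ‖T u‖ ≤ T.singularValues 1 * ‖u‖ := by
  have hS := T.isSymmetric_adjoint_comp_self
  set B := hS.eigenvectorBasis rfl with hB
  have happ : ∀ i, LinearMap.adjoint T (T (B i)) = (T.singularValues i ^ 2) • B i := by
    intro i
    rw [T.sq_singularValues_fin rfl]
    exact hS.apply_eigenvectorBasis rfl i
  have hcoef : ∀ v i, inner ℝ (B i) (LinearMap.adjoint T (T v))
      = T.singularValues i ^ 2 * inner ℝ (B i) v := by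
    intro v i
    rw [LinearMap.adjoint_inner_right, ← LinearMap.adjoint_inner_left, happ, real_inner_smul_left]
  have hle : ∀ i : Fin (Module.finrank ℝ V), (i : ℕ) ≠ 0 →
      T.singularValues i ≤ T.singularValues 1 :=
    fun i hi => T.singularValues_antitone (Nat.one_le_iff_ne_zero.2 hi)
  -- The Gram eigenvalues of positive index are below 1, while `e` has eigenvalue 1. So `e` is a
  -- multiple of the top eigenvector, to which `u` is therefore orthogonal.
  have hBe : ∀ i : Fin (Module.finrank ℝ V), (i : ℕ) ≠ 0 → inner ℝ (B i) e = 0 := by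
    intro i hi
    have h := hcoef e i
    rw [hTe] at h
    have h1 : T.singularValues i ^ 2 < 1 :=
      pow_lt_one₀ (T.singularValues_nonneg _) ((hle i hi).trans_lt hσ) two_ne_zero
    have h2 : (1 - T.singularValues i ^ 2) * inner ℝ (B i) e = 0 := by linarith
    exact (mul_eq_zero.1 h2).resolve_left (by linarith)
  have hBu : ∀ i : Fin (Module.finrank ℝ V), (i : ℕ) = 0 → inner ℝ (B i) u = 0 := by
    intro i hi
    have hsum : e = inner ℝ (B i) e • B i := by
      conv_lhs => rw [← B.sum_repr' e]
      refine Finset.sum_eq_single i (fun j _ hj => ?_) (by simp)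
      rw [hBe j (fun h => hj (Fin.ext (h.trans hi.symm))), zero_smul]
    have h0 : inner ℝ (B i) e ≠ 0 := fun h => he (by rw [hsum, h, zero_smul])
    rw [hsum, real_inner_smul_left] at hu
    exact (mul_eq_zero.1 hu).resolve_left h0
  refine le_of_sq_le_sq ?_ (mul_nonneg (T.singularValues_nonneg 1) (norm_nonneg u))
  have h1 : ‖T u‖ ^ 2 = ∑ i : Fin (Module.finrank ℝ V),
      T.singularValues i ^ 2 * inner ℝ (B i) u ^ 2 := by
    rw [← real_inner_self_eq_norm_sq, ← LinearMap.adjoint_inner_right, ← B.sum_inner_mul_inner]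
    refine Finset.sum_congr rfl fun i _ => ?_
    rw [hcoef, real_inner_comm]; ring
  rw [h1, mul_pow, ← B.sum_sq_inner_right u, Finset.mul_sum]
  refine Finset.sum_le_sum fun i _ => ?_
  by_cases hi : (i : ℕ) = 0
  · simp [hBu i hi]
  · exact mul_le_mul_of_nonneg_right
      (pow_le_pow_left₀ (T.singularValues_nonneg _) (hle i hi) 2) (sq_nonneg _)

variable {n : ℕ} {W : Matrix (Fin n) (Fin n) ℝ}

/-- Unit row and column sums make WᵀW fix the all-ones vector, whose orthogonal complement is the
mean-zero vectors. -/
theorem sum_sq_mulVec_le (hW : W ∈ doublyStochastic ℝ (Fin n)) (hσ : sigma₂ W < 1)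
    (u : Fin n → ℝ) (hu : ∑ i, u i = 0) :
    ∑ i, (W *ᵥ u) i ^ 2 ≤ sigma₂ W ^ 2 * ∑ i, u i ^ 2 := by
  rcases isEmpty_or_nonempty (Fin n) with hn | hn
  · simp
  have h := norm_apply_le_of_inner_eq_zero (toEuclideanLin W) (e := WithLp.toLp 2 1)
    (u := WithLp.toLp 2 u) ?_ ?_ hσ ?_
  · have h2 := pow_le_pow_left₀ (norm_nonneg _) h 2
    rw [mul_pow, EuclideanSpace.real_norm_sq_eq, EuclideanSpace.real_norm_sq_eq] at h2
    exact h2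
  · intro h
    have := congrFun (congrArg WithLp.ofLp h) hn.some
    simp at this
  · rw [← toEuclideanLin_conjTranspose_eq_adjoint, toLpLin_toLp, toLpLin_toLp,
      toLin'_apply, toLin'_apply, hW.2.1, conjTranspose_eq_transpose_of_trivial, mulVec_transpose,
      hW.2.2]
  · simpa [PiLp.inner_apply] using hu

theorem sum_mulVec (hW : W ∈ doublyStochastic ℝ (Fin n)) (u : Fin n → ℝ) :
    ∑ i, (W *ᵥ u) i = ∑ i, u i := by
  have : (1 : Fin n → ℝ) ⬝ᵥ (W *ᵥ u) = 1 ⬝ᵥ u := by rw [dotProduct_mulVec, hW.2.2]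
  simpa [dotProduct] using this

theorem sum_sq_pow_mulVec_le (hW : W ∈ doublyStochastic ℝ (Fin n)) (hσ : sigma₂ W < 1) (t : ℕ)
    (u : Fin n → ℝ) (hu : ∑ i, u i = 0) :
    ∑ i, ((W ^ t) *ᵥ u) i ^ 2 ≤ (sigma₂ W ^ t) ^ 2 * ∑ i, u i ^ 2 := by
  induction t with
  | zero => simp
  | succ t ih =>
    rw [pow_succ', ← mulVec_mulVec]
    refine (sum_sq_mulVec_le hW hσ _ ((sum_mulVec (pow_mem hW t) u).trans hu)).trans ?_
    rw [pow_succ' (sigma₂ W) t, mul_pow, mul_assoc]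
    exact mul_le_mul_of_nonneg_left ih (sq_nonneg _)

/-- `t` rounds of averaging shrink the distance to the mean by the factor `σ₂ ^ t`. -/
theorem stackedError_mixing_le {ι : Type*} [Fintype ι] (hW : W ∈ doublyStochastic ℝ (Fin n))
    (hσ : sigma₂ W ∈ Set.Ico 0 1) (t : ℕ) (x : Fin n → EuclideanSpace ℝ ι) :
    stackedError (fun i => ∑ j, (W ^ t) i j • x j) (mean x)
      ≤ sigma₂ W ^ t * stackedError x (mean x) := by
  rcases isEmpty_or_nonempty (Fin n) with hn | hn
  · simp [stackedError]
  have hrow := sum_row_of_mem_doublyStochastic (pow_mem hW t)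
  have hp : ∀ p, ∑ i, (x i - mean x) p = 0 := fun p => by
    simpa using congrFun (congrArg WithLp.ofLp (sum_sub_mean x)) p
  have hcoord : ∀ i p, ((∑ j, (W ^ t) i j • x j) - mean x) p
      = ((W ^ t) *ᵥ fun j => (x j - mean x) p) i := fun i p => by
    simp [mulVec, dotProduct, mul_sub, Finset.sum_sub_distrib, ← Finset.sum_mul, hrow]
  rw [stackedError, stackedError, Real.sqrt_le_left (mul_nonneg (pow_nonneg hσ.1 t)
    (Real.sqrt_nonneg _)), mul_pow, Real.sq_sqrt (by positivity)]
  simp_rw [EuclideanSpace.real_norm_sq_eq]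
  rw [Finset.sum_comm, Finset.sum_comm (s := Finset.univ (α := Fin n)), Finset.mul_sum]
  refine Finset.sum_le_sum fun p _ => ?_
  simp_rw [hcoord]
  exact sum_sq_pow_mulVec_le hW hσ.2 t _ (hp p)

end Mixing

/-! ### Invariance of the neighborhood and linear convergence -/

section Iteration

open Metric

theorem pow_lt_of_ceil_logb_lt {σ c : ℝ} (hσ : σ ∈ Set.Ico 0 1) (hc : 0 < c) {t : ℕ}
    (ht : ⌈Real.logb σ c⌉ < (t : ℤ)) : σ ^ t < c := by
  rcases hσ.1.eq_or_lt with rfl | hσ₀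
  -- `Real.logb 0 c` is `0`, so the bound forces `t` to be positive.
  · have : t ≠ 0 := by rintro rfl; simp at ht
    rwa [zero_pow this]
  · have h : Real.logb σ c < t := (Int.le_ceil _).trans_lt (by exact_mod_cast ht)
    rwa [Real.logb_lt_iff_lt_rpow_of_base_lt_one hσ₀ hσ.2 hc, Real.rpow_natCast] at h

variable {ι : Type*} [Fintype ι] {M : Set (EuclideanSpace ℝ ι)} {n : ℕ}
  {W : Matrix (Fin n) (Fin n) ℝ} {γ : ℝ} {t : ℕ} {x y : Fin n → EuclideanSpace ℝ ι}
  {a b : EuclideanSpace ℝ ι}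

theorem exists_proj_mean_eq_singleton (hγ : 0 < γ) (hR : IsProximallySmooth M (2 * γ))
    (hn : n ≠ 0) (hx : x ∈ neighborhood M γ n) :
    ∃ a, proj M (mean x) = {a} ∧ ∀ i, ‖x i - a‖ ≤ γ / 2 := by
  obtain ⟨-, a, ha, hxa⟩ := hx
  have hmean : ‖a - mean x‖ ≤ γ / 2 := by
    rw [norm_sub_rev, ← dist_eq_norm]
    exact mean_mem_of_convex (convex_closedBall a (γ / 2)) hn fun i => by
      rw [mem_closedBall, dist_eq_norm]; exact hxa i
  have huniq := hR.2 (mean x) (by rw [infDist_eq_of_mem_proj ha]; linarith)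
  exact ⟨a, Set.eq_singleton_iff_unique_mem.2 ⟨ha, fun b hb => huniq.unique hb ha⟩, hxa⟩

theorem stackedError_step_le (hM : IsCompact M) (hγ : 0 < γ)
    (hR : IsProximallySmooth M (2 * γ)) (hn : n ≠ 0) (hW : W ∈ doublyStochastic ℝ (Fin n))
    (hσ : sigma₂ W ∈ Set.Ico 0 1) (ha : a ∈ proj M (mean x)) (hxa : ∀ i, ‖x i - a‖ ≤ γ / 2)
    (hy : ∀ i, y i ∈ proj M (∑ j, (W ^ t) i j • x j)) :
    stackedError y a ≤ 2 * sigma₂ W ^ t * stackedError x a := by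
  have hWt := pow_mem hW t
  have hball : ∀ i, x i ∈ closedBall a (γ / 2) := fun i => by
    rw [mem_closedBall, dist_eq_norm]; exact hxa i
  have hmean : ‖mean x - a‖ ≤ γ / 2 := by
    rw [← dist_eq_norm]
    exact mean_mem_of_convex (convex_closedBall a (γ / 2)) hn hball
  have hz : ∀ i, ‖∑ j, (W ^ t) i j • x j - a‖ ≤ γ / 2 := fun i => by
    rw [← dist_eq_norm]
    exact (convex_closedBall a (γ / 2)).sum_mem (fun j _ => hWt.1 i j)
      (sum_row_of_mem_doublyStochastic hWt i) fun j _ => hball j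
  -- Both the mixed point and the mean lie within γ/2 of `M`, and `a` is the projection of the mean.
  have hya : ∀ i, ‖y i - a‖ ≤ 2 * ‖∑ j, (W ^ t) i j • x j - mean x‖ := fun i => by
    refine norm_sub_le_two_mul_of_mem_proj hγ hM hR ha (hy i) hmean ?_
    have := (hy i).2 a ha.1
    rw [norm_sub_rev, norm_sub_rev a] at this
    exact this.trans (hz i)
  calc stackedError y a
      ≤ 2 * stackedError (fun i => ∑ j, (W ^ t) i j • x j) (mean x) :=
        stackedError_le_mul_of_forall_norm_sub_le zero_le_two hya
    _ ≤ 2 * (sigma₂ W ^ t * stackedError x a) := by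
        refine mul_le_mul_of_nonneg_left ((stackedError_mixing_le hW hσ t x).trans ?_) zero_le_two
        exact mul_le_mul_of_nonneg_left (stackedError_mean_le x a) (pow_nonneg hσ.1 t)
    _ = _ := by ring

/-- Go from `y i` to `a`, to the mean, to `b`: each leg is at most `δ`, the last because `b` is no
farther from the mean than `a`. -/
theorem norm_sub_le_of_stackedError_le {δ : ℝ} (hn : n ≠ 0) (ha : a ∈ M)
    (hya : stackedError y a ≤ δ) (hb : b ∈ proj M (mean y)) (i : Fin n) :
    ‖y i - b‖ ≤ 3 * δ := by
  have hi : ∀ i, ‖y i - a‖ ≤ δ := fun i => (norm_sub_le_stackedError y a i).trans hya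
  have hm : ‖a - mean y‖ ≤ δ := by
    rw [norm_sub_rev, ← dist_eq_norm]
    exact mean_mem_of_convex (convex_closedBall a δ) hn fun i => by
      rw [mem_closedBall, dist_eq_norm]; exact hi i
  have hbm := (hb.2 a ha).trans hm
  calc ‖y i - b‖ = ‖(y i - a) + (a - mean y) - (b - mean y)‖ := by congr 1; abel
    _ ≤ ‖y i - a‖ + ‖a - mean y‖ + ‖b - mean y‖ :=
        (norm_sub_le _ _).trans (add_le_add_left (norm_add_le _ _) _)
    _ ≤ 3 * δ := by linarith [hi i]

end Iteration

end Consensus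

theorem mainTheorem1 (d r n : ℕ) (M : Set (Consensus.RMat d r))
    (hM_compact : IsCompact M) (hM_submanifold : Consensus.IsSubmanifold 2 M)
    (γ : ℝ) (hγ : 0 < γ) (hM_prox : Consensus.IsProximallySmooth M (2 * γ))
    (G : SimpleGraph (Fin n)) (W : Matrix (Fin n) (Fin n) ℝ)
    (hW : Consensus.IsMixingMatrix G W)
    (t : ℕ)
    (ht : max ⌈Real.logb (Consensus.sigma₂ W) (γ / (24 * √(n : ℝ) * Metric.diam M))⌉
        ⌈Real.logb (Consensus.sigma₂ W) (1 / 2)⌉ < (t : ℤ))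
    (x : ℕ → Fin n → Consensus.RMat d r)
    (hx : Consensus.IsConsensusIteration M W t x)
    (hx₀ : x 0 ∈ Consensus.neighborhood M γ n) :
    2 * Consensus.sigma₂ W ^ t < 1 ∧
    (∀ k, x k ∈ Consensus.neighborhood M γ n) ∧
    ∃ xbar : ℕ → Consensus.RMat d r,
      (∀ k, Consensus.proj M (Consensus.mean (x k)) = {xbar k}) ∧
      ∀ k, Consensus.stackedError (x (k + 1)) (xbar (k + 1)) ≤
        2 * Consensus.sigma₂ W ^ t * Consensus.stackedError (x k) (xbar k) := by
  open Consensus in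
  have hn : n ≠ 0 := by
    have := hW.connected.nonempty
    exact (Fin.pos_iff_nonempty.2 this).ne'
  have hσ := hW.sigma₂_mem
  have hσt : 0 ≤ sigma₂ W ^ t := pow_nonneg hσ.1 t
  have hhalf : sigma₂ W ^ t < 1 / 2 :=
    pow_lt_of_ceil_logb_lt hσ (by norm_num) ((le_max_right _ _).trans_lt ht)
  have hsmall : sigma₂ W ^ t * (√n * Metric.diam M) ≤ γ / 24 := by
    -- If √n·diam vanishes, the logarithm carries no information, but the claim is trivial.
    rcases (mul_nonneg (Real.sqrt_nonneg n) (Metric.diam_nonneg (s := M))).eq_or_lt with h | h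
    · rw [← h]; linarith
    · have := pow_lt_of_ceil_logb_lt hσ (by rw [mul_assoc]; positivity)
        ((le_max_left _ _).trans_lt ht)
      rw [lt_div_iff₀ (by rw [mul_assoc]; positivity)] at this
      linarith
  have hstep : ∀ k, x k ∈ neighborhood M γ n → ∀ a ∈ proj M (mean (x k)),
      stackedError (x (k + 1)) a ≤ 2 * sigma₂ W ^ t * stackedError (x k) a := by
    intro k hk a ha
    obtain ⟨c, hc, hxc⟩ := exists_proj_mean_eq_singleton hγ hM_prox hn hk
    obtain rfl : a = c := by rwa [hc] at ha
    exact stackedError_step_le hM_compact hγ hM_prox hn hW.doubly_stochastic hσ ha hxc (hx k)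
  have hdiam : ∀ k, x k ∈ neighborhood M γ n → ∀ a ∈ M,
      stackedError (x k) a ≤ √n * Metric.diam M := fun k hk a ha =>
    stackedError_le_sqrt_mul Metric.diam_nonneg fun i => by
      rw [← dist_eq_norm]
      exact Metric.dist_le_diam_of_mem hM_compact.isBounded (hk.1 i) ha
  have hmem : ∀ k, x k ∈ neighborhood M γ n := by
    intro k
    induction k with
    | zero => exact hx₀
    | succ k ih =>
      obtain ⟨a, ha, -⟩ := ih.2
      -- Here γ/12 = 2·γ/24, and the factor 3 of `norm_sub_le_of_stackedError_le` then gives γ/4 ≤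
      -- γ/2.
      have herr : stackedError (x (k + 1)) a ≤ γ / 12 := by
        have := mul_le_mul_of_nonneg_left (hdiam k ih a ha.1) hσt
        linarith [hstep k ih a ha]
      obtain ⟨b, hb⟩ := exists_mem_proj hM_compact ⟨a, ha.1⟩ (mean (x (k + 1)))
      refine ⟨fun i => (hx k i).1, b, hb, fun i => ?_⟩
      linarith [norm_sub_le_of_stackedError_le hn ha.1 herr hb i]
  choose xbar hxbar _ using fun k => exists_proj_mean_eq_singleton hγ hM_prox hn (hmem k)
  have hbar : ∀ k, xbar k ∈ proj M (mean (x k)) := fun k => by rw [hxbar]; rfl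
  exact ⟨by linarith, hmem, xbar, hxbar, fun k =>
    (stackedError_le_of_mem_proj_mean (hbar (k + 1)) (hbar k).1).trans
      (hstep k (hmem k) _ (hbar k))⟩
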